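/- There are absolute constants $c,c'>0$ such that the following holds. Let $z_1,\dots,z_n$ be i.i.d. observations in a measurable space $\mathrm Z$, let $\varphi:\mathrm Z\times\mathbb R^p\to\mathbb R$ be measurable in its first argument, and put $f_i(\theta)=\varphi(z_i,\theta)$ and $f(\theta)=\frac1n\sum_{i=1}^n f_i(\theta)$. Assume that almost surely every $f_i$ is a quadratic function of $\theta$. For nonempty $S\subseteq[n]$ let $\mathbf H_S(\theta)=\frac1{|S|}\sum_{i\in S}\nabla^2 f_i(\theta)$. Let $\mathcal C\subset\mathbb R^p$ be closed, convex and bounded, and let $K$ and $M_1,\dots,M_n$ be deterministic constants such that almost surely $\|\nabla^2 f_i(\theta)\|_2\le K$ for all $i$ and all $\theta\in\mathcal C$, and $\|\mathbf H_S(\theta)-\mathbf H_S(\theta')\|_2\le M_{|S|}\|\theta-\theta'\|_2$ for all nonempty $S\subseteq[n]$ and all $\theta,\theta'\in\mathcal C$. Let $\theta_*$ be a random vector which almost surely minimizes $f$ over $\mathbb R^p$, and assume that the event $\mathcal E=\{\theta_*\in\mathcal C\}$ has positive probability. Let $S_0,S_1,\dots\subseteq[n]$ be random sets which may depend on each other in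 any way, but such that the sequence $(S_t)_t$ is independent of $(z_1,\dots,z_n)$. Fix a rank $r$ with $r+1\le p$, an initial point $\hat\theta^0$ and step sizes $\eta_t$ (these may be random), and let the NewSamp iterates be $$\hat\theta^{t+1}=\mathcal P_{\mathcal C}\big(\hat\theta^t-\eta_t\mathbf Q^t\nabla f(\hat\theta^t)\big),\qquad \mathbf Q^t=\frac1{\lambda^t_{r+1}}I+\sum_{k=1}^r\Big(\frac1{\lambda^t_k}-\frac1{\lambda^t_{r+1}}\Big)u^t_k(u^t_k)^{T},$$ where $\mathcal P_{\mathcal C}$ is the Euclidean projection onto $\mathcal C$, $\lambda^t_1\ge\dots\ge\lambda^t_p$ are the eigenvalues of $\mathbf H_{S_t}(\hat\theta^t)$ and $u^t_1,\dots,u^t_p$ are corresponding orthonormal eigenvectors. Let $t\ge0$, and assume that, almost surely conditionally on $\mathcal E$, $$\lambda^t_{r+1}>0,\qquad 0<\eta_t\le\frac{2}{1+\lambda^t_p/\lambda^t_{r+1}},\qquad \frac{\operatorname{diam}(\mathcal C)^2(M_n+M_{|S_t|})^2|S_t|}{K^2}>e .$$ Then, conditionally on $\mathcal E$, with probability at least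 $1-c_{\mathcal E}e^{-p}$, where $c_{\mathcal E}=c/\mathbb P(\mathcal E)$, $$\|\hat\theta^{t+1}-\theta_*\|_2\le\xi_1^t\,\|\hat\theta^t-\theta_*\|_2,$$ $$\xi_1^t=1-\eta_t\frac{\lambda^t_p}{\lambda^t_{r+1}}+\eta_t\frac{c'K}{\lambda^t_{r+1}}\sqrt{\frac{p}{|S_t|}\log\!\left(\frac{\operatorname{diam}(\mathcal C)^2\,(M_n+M_{|S_t|})^2\,|S_t|}{K^2}\right)} .$$ -/

import Mathlib

open MeasureTheory ProbabilityTheory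

noncomputable section

namespace NewSamp

/-- The parameter space `ℝ^p` with its Euclidean norm. -/
abbrev Vec (p : ℕ) : Type := EuclideanSpace ℝ (Fin p)

/-- The Hessian of `g` at `x`, the derivative of the gradient, as a linear operator on `ℝ^p`.
Its norm is the spectral norm. -/
def hessian {p : ℕ} (g : Vec p → ℝ) (x : Vec p) : Vec p →L[ℝ] Vec p :=
  fderiv ℝ (gradient g) x

/-- The average `f(θ) = (1/n) ∑ i, f_i(θ)`. -/
def objective {n p : ℕ} (f : Fin n → Vec p → ℝ) (θ : Vec p) : ℝ :=
  (n : ℝ)⁻¹ * ∑ i, f i θ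

/-- The sub-sampled Hessian `H_S(θ) = (1/|S|) ∑ i ∈ S, ∇² f_i(θ)`. -/
def subHessian {n p : ℕ} (f : Fin n → Vec p → ℝ) (S : Finset (Fin n)) (θ : Vec p) :
    Vec p →L[ℝ] Vec p :=
  (S.card : ℝ)⁻¹ • ∑ i ∈ S, hessian (f i) θ

open Classical in
/-- `eig A k` is the `k`-th largest eigenvalue (`1 ≤ k ≤ p`, with multiplicity) of the symmetric
operator `A` on `ℝ^p`. -/
def eig {p : ℕ} (A : Vec p →L[ℝ] Vec p) (k : ℕ) : ℝ :=
  if h : (A : Vec p →ₗ[ℝ] Vec p).IsSymmetric ∧ 1 ≤ k ∧ k ≤ p then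
    h.1.eigenvalues finrank_euclideanSpace_fin ⟨k - 1, by omega⟩
  else 0

open Classical in
/-- `eigVec A k` is the `k`-th vector of an orthonormal eigenbasis of the symmetric operator `A`,
with eigenvalue `eig A k`. -/
def eigVec {p : ℕ} (A : Vec p →L[ℝ] Vec p) (k : ℕ) : Vec p :=
  if h : (A : Vec p →ₗ[ℝ] Vec p).IsSymmetric ∧ 1 ≤ k ∧ k ≤ p then
    h.1.eigenvectorBasis finrank_euclideanSpace_fin ⟨k - 1, by omega⟩
  else 0

/-- The scaling matrix
`Q = λ_{r+1}⁻¹ I + ∑_{k=1}^{r} (λ_k⁻¹ - λ_{r+1}⁻¹) u_k u_kᵀ`. -/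
def scaling {p : ℕ} (r : ℕ) (A : Vec p →L[ℝ] Vec p) : Vec p →L[ℝ] Vec p :=
  (eig A (r + 1))⁻¹ • ContinuousLinearMap.id ℝ (Vec p) +
    ∑ k ∈ Finset.Icc 1 r, ((eig A k)⁻¹ - (eig A (r + 1))⁻¹) •
      (innerSL ℝ (eigVec A k)).smulRight (eigVec A k)

open Classical in
/-- The Euclidean projection onto `C` (a minimizer of the distance to `x` over `C`; it exists and
is unique when `C` is nonempty, closed and convex). -/
def proj {p : ℕ} (C : Set (Vec p)) (x : Vec p) : Vec p :=
  if h : ∃ y ∈ C, ∀ y' ∈ C, ‖x - y‖ ≤ ‖x - y'‖ then h.choose else x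

/-- The iterates `θ^t` of NewSamp with feasible set `C`, rank `r`, step sizes `η t`, sub-samples
`S t` and initial point `θ0`. -/
def iter {n p : ℕ} (C : Set (Vec p)) (r : ℕ) (f : Fin n → Vec p → ℝ)
    (η : ℕ → ℝ) (S : ℕ → Finset (Fin n)) (θ0 : Vec p) : ℕ → Vec p
  | 0 => θ0
  | t + 1 =>
    proj C (iter C r f η S θ0 t -
      η t • scaling r (subHessian f (S t) (iter C r f η S θ0 t))
        (gradient (objective f) (iter C r f η S θ0 t)))

/-- `H_S` is Lipschitz on `C` with constant `M |S|`, for every nonempty `S`. -/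
def LipschitzHessian {n p : ℕ} (C : Set (Vec p)) (M : ℕ → ℝ) (f : Fin n → Vec p → ℝ) : Prop :=
  ∀ S : Finset (Fin n), S.Nonempty → ∀ θ ∈ C, ∀ θ' ∈ C,
    ‖subHessian f S θ - subHessian f S θ'‖ ≤ M S.card * ‖θ - θ'‖

/-- The Hessians of all `f_i` are bounded by `K` on `C`. -/
def BoundedHessian {n p : ℕ} (C : Set (Vec p)) (K : ℝ) (f : Fin n → Vec p → ℝ) : Prop :=
  ∀ i, ∀ θ ∈ C, ‖hessian (f i) θ‖ ≤ K

/-- `g` is a quadratic function. -/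
def IsQuadratic {p : ℕ} (g : Vec p → ℝ) : Prop :=
  ∃ (A : Vec p →L[ℝ] Vec p) (b : Vec p) (a : ℝ),
    ∀ θ, g θ = (1 / 2) * inner ℝ (A θ) θ + inner ℝ b θ + a

/-- The `z_i` are i.i.d. random variables with law `D`. -/
def IIDObservations {Ω Z : Type*} [MeasurableSpace Ω] [MeasurableSpace Z] {n : ℕ}
    (P : Measure Ω) (D : Measure Z) (z : Fin n → Ω → Z) : Prop :=
  (∀ i, Measurable (z i)) ∧ (∀ i, P.map (z i) = D) ∧ iIndepFun z P

/-- Sequentially dependent sub-sampling: the random sets `S_t` may depend on each other in any way,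
but the sequence `(S_t)` is independent of the data `(z_i)`. -/
def SequentialSubsampling {Ω Z : Type*} [MeasurableSpace Ω] [MeasurableSpace Z] {n : ℕ}
    (P : Measure Ω) (z : Fin n → Ω → Z) (S : ℕ → Ω → Finset (Fin n)) : Prop :=
  (∀ t, Measurable (S t)) ∧ IndepFun (fun ω t => S t ω) (fun ω i => z i ω) P

/-- The argument `diam(C)² (M_n + M_s)² s / K²` of the logarithm, for sample size `s`. -/
def logArg {p : ℕ} (C : Set (Vec p)) (M : ℕ → ℝ) (K : ℝ) (n s : ℕ) : ℝ :=
  Metric.diam C ^ 2 * (M n + M s) ^ 2 * s / K ^ 2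

/-- The linear coefficient
`ξ₁ = 1 - η λ_p / λ_{r+1} + η (c' K / λ_{r+1}) √((p / s) log (diam(C)² (M_n + M_s)² s / K²))`,
with `λ_k` the `k`-th largest eigenvalue of `A` and `s` the sample size. -/
def xi1 {p : ℕ} (c' : ℝ) (C : Set (Vec p)) (M : ℕ → ℝ) (K : ℝ) (n s r : ℕ) (η : ℝ)
    (A : Vec p →L[ℝ] Vec p) : ℝ :=
  1 - η * (eig A p / eig A (r + 1)) +
    η * (c' * K / eig A (r + 1)) *
      Real.sqrt ((p : ℝ) / (s : ℝ) * Real.log (logArg C M K n s))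

end NewSamp

end

/-! For quadratic `f_i` the Hessians are constant and `∇f(θ) = H_[n] (θ - θ_*)`. Projecting onto `C
∋ θ_*` does not increase the distance to `θ_*`, so one step is governed by `I - ηQ H_[n] = (I - ηQ
H_S) - ηQ (H_[n] - H_S)`. `Q` and `H_S` share an eigenbasis: the first term has norm at most `1 -
ηλ_p/λ_{r+1}`, and `‖Q‖ ≤ 1/λ_{r+1}` (`norm_iter_succ_sub_le`).

It remains to bound `‖H_[n] - H_S‖` by a multiple of `K √(p/|S|)`. A matrix entry `⟨H x, y⟩` is an
average of second differences of the `f_i`, which are i.i.d., bounded and measurable without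
differentiating `φ`. Hoeffding's inequality and a union bound over pairs from a net of `5^p` vectors
compare both Hessians with the common mean, with failure probability of order `e^{-p}`. As the
Hessians do not depend on `θ`, no union over `C` is needed and the data-dependent iterate is
harmless. Independence lets the random `S_t` be treated as fixed; conditioning on `E` costs the
factor `1/P(E)`. -/

namespace NewSamp

/-! ### Projection onto a closed convex set. -/

section Projection

variable {p : ℕ}

/-- The Euclidean projection onto a closed convex set does not increase the distance to points of
the set. -/
theorem norm_proj_sub_le {C : Set (Vec p)} (hconv : Convex ℝ C) (hclosed : IsClosed C)
    {y : Vec p} (hy : y ∈ C) (x : Vec p) : ‖proj C x - y‖ ≤ ‖x - y‖ := by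
  have hex : ∃ v ∈ C, ∀ v' ∈ C, ‖x - v‖ ≤ ‖x - v'‖ := by
    obtain ⟨v, hv, hmin⟩ := exists_norm_eq_iInf_of_complete_convex ⟨y, hy⟩ hclosed.isComplete
      hconv x
    refine ⟨v, hv, fun v' hv' => hmin ▸ ?_⟩
    exact ciInf_le ⟨0, by rintro _ ⟨w, rfl⟩; exact norm_nonneg _⟩ (⟨v', hv'⟩ : C)
  have hproj : proj C x = hex.choose := dif_pos hex
  obtain ⟨hv, hmin⟩ := hex.choose_spec
  rw [← hproj] at hv hmin
  have : Nonempty C := ⟨⟨y, hy⟩⟩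
  have heq : ‖x - proj C x‖ = ⨅ w : C, ‖x - w‖ :=
    le_antisymm (le_ciInf fun w => hmin w w.2)
      (ciInf_le ⟨0, by rintro _ ⟨w, rfl⟩; exact norm_nonneg _⟩ (⟨_, hv⟩ : C))
  -- The angle at the projection is not acute, so the cross term in `‖x - y‖ ^ 2` below is
  -- nonnegative.
  have hobt := (norm_eq_iInf_iff_real_inner_le_zero hconv hv).1 heq y hy
  have hsplit : x - y = (x - proj C x) - (y - proj C x) := by abel
  have hsq : ‖x - y‖ ^ 2 = ‖x - proj C x‖ ^ 2 - 2 * inner ℝ (x - proj C x) (y - proj C x)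
      + ‖y - proj C x‖ ^ 2 := by
    rw [hsplit, norm_sub_sq_real]
  rw [norm_sub_rev (proj C x) y]
  exact le_of_sq_le_sq (by nlinarith [sq_nonneg ‖x - proj C x‖]) (norm_nonneg _)

end Projection

/-! ### Spectral bounds for the scaling matrix. -/

section Spectral

variable {p : ℕ}

theorem norm_le_of_apply_orthonormalBasis {ι E : Type*} [Fintype ι] [NormedAddCommGroup E]
    [InnerProductSpace ℝ E] (b : OrthonormalBasis ι ℝ E) (T : E →L[ℝ] E) {ν : ι → ℝ} {c : ℝ}
    (hc : 0 ≤ c) (hT : ∀ i, T (b i) = ν i • b i) (hν : ∀ i, |ν i| ≤ c) : ‖T‖ ≤ c := by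
  refine T.opNorm_le_bound hc fun x => ?_
  have hx : T x = ∑ i, (ν i * inner ℝ (b i) x) • b i := by
    conv_lhs => rw [← b.sum_repr' x]
    simp [map_sum, hT, smul_smul, mul_comm]
  have hcoord : ∀ i, inner ℝ (b i) (T x) = ν i * inner ℝ (b i) x := fun i => by
    rw [hx, b.orthonormal.inner_right_fintype]
  refine le_of_sq_le_sq ?_ (by positivity)
  rw [mul_pow, ← b.sum_sq_norm_inner_right (T x), ← b.sum_sq_norm_inner_right x, Finset.mul_sum]
  refine Finset.sum_le_sum fun i _ => ?_
  rw [hcoord, norm_mul, mul_pow]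
  gcongr
  exact hν i

variable {A : Vec p →L[ℝ] Vec p}

theorem eig_succ (hA : (A : Vec p →ₗ[ℝ] Vec p).IsSymmetric) {k : ℕ} (hk : k < p) :
    eig A (k + 1) = hA.eigenvalues finrank_euclideanSpace_fin ⟨k, hk⟩ := by
  have h : (A : Vec p →ₗ[ℝ] Vec p).IsSymmetric ∧ 1 ≤ k + 1 ∧ k + 1 ≤ p := ⟨hA, by omega, hk⟩
  rw [eig, dif_pos h]
  rfl

theorem eigVec_succ (hA : (A : Vec p →ₗ[ℝ] Vec p).IsSymmetric) {k : ℕ} (hk : k < p) :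
    eigVec A (k + 1) = hA.eigenvectorBasis finrank_euclideanSpace_fin ⟨k, hk⟩ := by
  have h : (A : Vec p →ₗ[ℝ] Vec p).IsSymmetric ∧ 1 ≤ k + 1 ∧ k + 1 ≤ p := ⟨hA, by omega, hk⟩
  rw [eigVec, dif_pos h]
  rfl

theorem eig_anti (hA : (A : Vec p →ₗ[ℝ] Vec p).IsSymmetric) {j k : ℕ} (hj : 1 ≤ j)
    (hjk : j ≤ k) (hk : k ≤ p) : eig A k ≤ eig A j := by
  obtain ⟨j, rfl⟩ := Nat.exists_eq_add_of_le' hj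
  obtain ⟨k, rfl⟩ := Nat.exists_eq_add_of_le' (hj.trans hjk)
  rw [eig_succ hA (by omega), eig_succ hA (by omega)]
  exact hA.eigenvalues_antitone _ (by simpa using hjk)

theorem apply_eigenvectorBasis (hA : (A : Vec p →ₗ[ℝ] Vec p).IsSymmetric) (i : Fin p) :
    A (hA.eigenvectorBasis finrank_euclideanSpace_fin i) =
      eig A (i + 1) • hA.eigenvectorBasis finrank_euclideanSpace_fin i := by
  rw [eig_succ hA i.2]
  exact hA.apply_eigenvectorBasis finrank_euclideanSpace_fin i

/-- Only the rank-one term `k = i + 1` acts on the `i`-th (0-based) basis vector; it is present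
exactly when `i < r`, and its coefficient then cancels `λ_{r+1}⁻¹`. -/
theorem scaling_apply_eigenvectorBasis (hA : (A : Vec p →ₗ[ℝ] Vec p).IsSymmetric) {r : ℕ}
    (hr : r + 1 ≤ p) (i : Fin p) :
    scaling r A (hA.eigenvectorBasis finrank_euclideanSpace_fin i) =
      (if (i : ℕ) < r then (eig A (i + 1))⁻¹ else (eig A (r + 1))⁻¹) •
        hA.eigenvectorBasis finrank_euclideanSpace_fin i := by
  set b := hA.eigenvectorBasis finrank_euclideanSpace_fin with hb
  have hterm : ∀ k ∈ Finset.Icc 1 r, ((eig A k)⁻¹ - (eig A (r + 1))⁻¹) •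
      (innerSL ℝ (eigVec A k)).smulRight (eigVec A k) (b i) =
      if k = i + 1 then ((eig A (i + 1))⁻¹ - (eig A (r + 1))⁻¹) • b i else 0 := by
    intro k hk
    obtain ⟨hk1, hkr⟩ := Finset.mem_Icc.1 hk
    obtain ⟨k, rfl⟩ := Nat.exists_eq_add_of_le' hk1
    rw [eigVec_succ hA (by omega : k < p), ← hb, ContinuousLinearMap.smulRight_apply,
      innerSL_apply_apply, orthonormal_iff_ite.1 b.orthonormal]
    by_cases hki : k = i
    · subst hki
      simp
    · have : (⟨k, by omega⟩ : Fin p) ≠ i := fun h => hki (by rw [← h])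
      simp [this, hki]
  simp only [scaling, add_apply, FunLike.coe_smul, Pi.smul_apply,
    ContinuousLinearMap.id_apply, sum_apply]
  rw [Finset.sum_congr rfl hterm, Finset.sum_ite_eq']
  by_cases hi : (i : ℕ) < r
  · rw [if_pos (Finset.mem_Icc.2 ⟨by omega, by omega⟩), if_pos hi, ← add_smul]
    congr 1
    ring
  · rw [if_neg (by simp; omega), if_neg hi, add_zero]

theorem norm_scaling_le (hA : (A : Vec p →ₗ[ℝ] Vec p).IsSymmetric) {r : ℕ}
    (hr : r + 1 ≤ p) (hpos : 0 < eig A (r + 1)) :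
    ‖scaling r A‖ ≤ (eig A (r + 1))⁻¹ := by
  refine norm_le_of_apply_orthonormalBasis _ _ (inv_nonneg.2 hpos.le)
    (scaling_apply_eigenvectorBasis hA hr) fun i => ?_
  split_ifs with hi
  · have h := eig_anti hA (by omega : 1 ≤ (i : ℕ) + 1) (by omega : (i : ℕ) + 1 ≤ r + 1) hr
    rw [abs_of_nonneg (inv_nonneg.2 (hpos.le.trans h))]
    exact inv_anti₀ hpos h
  · rw [abs_of_pos (inv_pos.2 hpos)]

/-- The scaled operator contracts, at the rate given by its smallest eigenvalue. -/
theorem norm_id_sub_scaling_comp_le (hA : (A : Vec p →ₗ[ℝ] Vec p).IsSymmetric) {r : ℕ}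
    (hr : r + 1 ≤ p) (hpos : 0 < eig A (r + 1)) {η : ℝ}
    (hη : 0 < η) (hη' : η ≤ 2 / (1 + eig A p / eig A (r + 1))) :
    ‖ContinuousLinearMap.id ℝ (Vec p) - η • (scaling r A).comp A‖ ≤
      1 - η * (eig A p / eig A (r + 1)) := by
  set ρ := eig A p / eig A (r + 1) with hρ
  -- `λ_p` may be negative, but `1 + ρ ≤ 0` would make the upper bound on the positive step size
  -- nonpositive.
  have hden : 0 < 1 + ρ := by
    by_contra h
    have := div_nonpos_of_nonneg_of_nonpos zero_le_two (not_lt.1 h)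
    linarith
  have hstep : η * (1 + ρ) ≤ 2 := (le_div_iff₀ hden).1 hη'
  have hρ1 : ρ ≤ 1 := (div_le_one hpos).2 (eig_anti hA (by omega) hr le_rfl)
  have hprod : η * ρ ≤ η := by nlinarith
  -- The eigenvalues are `1 - η` or `1 - η λ_i/λ_{r+1}` with `λ_i/λ_{r+1} ∈ [ρ, 1]`, so all lie in
  -- `[1 - η, 1 - ηρ]`; `1 - η ≥ -(1 - ηρ)` is exactly `hstep`.
  refine norm_le_of_apply_orthonormalBasis (hA.eigenvectorBasis finrank_euclideanSpace_fin) _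
    (ν := fun i => 1 - η * (eig A (i + 1) *
      (if (i : ℕ) < r then (eig A (i + 1))⁻¹ else (eig A (r + 1))⁻¹)))
    (by linarith) (fun i => ?_) fun i => ?_
  · simp only [FunLike.coe_sub, Pi.sub_apply, FunLike.coe_smul, Pi.smul_apply,
      ContinuousLinearMap.id_apply, ContinuousLinearMap.comp_apply]
    rw [apply_eigenvectorBasis hA, map_smul, scaling_apply_eigenvectorBasis hA hr, sub_smul,
      one_smul, smul_smul, smul_smul, mul_assoc]
  · rw [abs_le]
    by_cases hi : (i : ℕ) < r
    · have h := eig_anti hA (by omega : 1 ≤ (i : ℕ) + 1) (by omega : (i : ℕ) + 1 ≤ r + 1) hr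
      simp only [if_pos hi]
      rw [mul_inv_cancel₀ (hpos.trans_le h).ne']
      constructor <;> linarith
    · have h1 : eig A (i + 1) * (eig A (r + 1))⁻¹ ≤ 1 := by
        rw [← div_eq_mul_inv, div_le_one hpos]
        exact eig_anti hA (by omega) (by omega) i.2
      have h2 : ρ ≤ eig A (i + 1) * (eig A (r + 1))⁻¹ := by
        rw [hρ, div_eq_mul_inv]
        exact mul_le_mul_of_nonneg_right (eig_anti hA (by omega) i.2 le_rfl)
          (inv_nonneg.2 hpos.le)
      simp only [if_neg hi]
      constructor <;> nlinarith

end Spectral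

/-! ### Quadratic functions and one NewSamp step. -/

section Quadratic

variable {n p : ℕ}

/-- The second difference of `g` at `0` in the directions `x` and `y`. -/
def secondDifference (g : Vec p → ℝ) (x y : Vec p) : ℝ :=
  g (x + y) - g x - g y + g 0

theorem IsQuadratic.exists_hasGradientAt {g : Vec p → ℝ} (hg : IsQuadratic g) :
    ∃ (B : Vec p →L[ℝ] Vec p) (b : Vec p), (B : Vec p →ₗ[ℝ] Vec p).IsSymmetric ∧
      (∀ θ, HasGradientAt g (B θ + b) θ) ∧ (∀ θ, hessian g θ = B) ∧
      ∀ x y, inner ℝ (B x) y = secondDifference g x y := by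
  obtain ⟨A, b, a, hg⟩ := hg
  -- The matrix in `IsQuadratic` need not be symmetric; the Hessian is its symmetric part.
  set B : Vec p →L[ℝ] Vec p := (1 / 2 : ℝ) • (A + A.adjoint) with hB
  have hinner : ∀ x y : Vec p, inner ℝ (B x) y = (1 / 2) * (inner ℝ (A x) y + inner ℝ x (A y)) := by
    intro x y
    simp [hB, inner_smul_left, inner_add_left, ContinuousLinearMap.adjoint_inner_left]
    ring
  have hgrad : ∀ θ, HasGradientAt g (B θ + b) θ := by
    intro θ
    rw [hasGradientAt_iff_hasFDerivAt]
    have h1 : HasFDerivAt (fun θ : Vec p => (1 / 2 : ℝ) * inner ℝ (A θ) θ + inner ℝ b θ + a)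
        ((1 / 2 : ℝ) • ((fderivInnerCLM ℝ (A θ, θ)).comp (A.prod (.id ℝ _))) + innerSL ℝ b) θ :=
      (((A.hasFDerivAt.inner ℝ (hasFDerivAt_id θ)).const_mul (1 / 2 : ℝ)).add
        (innerSL ℝ b).hasFDerivAt).add_const a
    rw [show g = _ from funext hg]
    refine h1.congr_fderiv (ContinuousLinearMap.ext fun x => ?_)
    simp [hinner, real_inner_comm]
  refine ⟨B, b, fun x y => ?_, hgrad, fun θ => ?_, fun x y => ?_⟩
  · change inner ℝ (B x) y = inner ℝ x (B y)
    rw [← real_inner_comm x, hinner, hinner, real_inner_comm (A x) y, real_inner_comm (A y) x]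
    ring
  · rw [hessian, gradient_eq hgrad]
    exact (B.hasFDerivAt.add_const b).fderiv
  · simp only [secondDifference, hg, hinner, map_add, inner_add_left, inner_add_right, map_zero,
      inner_zero_right, real_inner_comm x (A y)]
    ring

theorem IsQuadratic.abs_secondDifference_le {g : Vec p → ℝ} (hg : IsQuadratic g) {K : ℝ}
    {θ : Vec p} (hK : ‖hessian g θ‖ ≤ K) (x y : Vec p) :
    |secondDifference g x y| ≤ K * ‖x‖ * ‖y‖ := by
  obtain ⟨B, b, -, -, hB, hi⟩ := hg.exists_hasGradientAt
  rw [← hi]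
  exact (abs_real_inner_le_norm _ _).trans (mul_le_mul_of_nonneg_right
    (ContinuousLinearMap.le_of_opNorm_le _ (hB θ ▸ hK) x) (norm_nonneg y))

variable {f : Fin n → Vec p → ℝ}

theorem subHessian_isSymmetric (hf : ∀ i, IsQuadratic (f i)) (S : Finset (Fin n)) (θ : Vec p) :
    (subHessian f S θ : Vec p →ₗ[ℝ] Vec p).IsSymmetric := by
  intro x y
  simp only [subHessian, ContinuousLinearMap.coe_coe, FunLike.coe_smul, Pi.smul_apply,
    sum_apply, inner_smul_left, inner_smul_right, sum_inner, inner_sum]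
  congr 1
  refine Finset.sum_congr rfl fun i _ => ?_
  obtain ⟨B, b, hs, -, hB, -⟩ := (hf i).exists_hasGradientAt
  rw [hB]
  exact hs x y

theorem inner_subHessian (hf : ∀ i, IsQuadratic (f i)) (S : Finset (Fin n)) (θ x y : Vec p) :
    inner ℝ (subHessian f S θ x) y =
      (S.card : ℝ)⁻¹ * ∑ i ∈ S, secondDifference (f i) x y := by
  simp only [subHessian, FunLike.coe_smul, Pi.smul_apply,
    sum_apply, inner_smul_left, sum_inner]
  congr 1
  refine Finset.sum_congr rfl fun i _ => ?_
  obtain ⟨B, b, -, -, hB, hi⟩ := (hf i).exists_hasGradientAt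
  rw [hB, hi]

/-- At a minimizer the gradient vanishes, and the gradient of a quadratic function is affine. -/
theorem gradient_objective_eq (hf : ∀ i, IsQuadratic (f i)) {θ' : Vec p}
    (hmin : ∀ θ, objective f θ' ≤ objective f θ)
    (θ : Vec p) :
    gradient (objective f) θ = subHessian f Finset.univ θ (θ - θ') := by
  choose B b hs hgrad hhess _ using fun i => (hf i).exists_hasGradientAt
  have hobj : ∀ θ, HasGradientAt (objective f) ((n : ℝ)⁻¹ • ∑ i, (B i θ + b i)) θ := by
    intro θ
    rw [hasGradientAt_iff_hasFDerivAt, map_smul, map_sum]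
    exact (HasFDerivAt.fun_sum fun i _ => (hgrad i θ).hasFDerivAt).const_mul _
  have hzero : (n : ℝ)⁻¹ • ∑ i, (B i θ' + b i) = 0 := by
    have h := IsLocalMin.fderiv_eq_zero (f := objective f) (a := θ') (.of_forall hmin)
    rw [← (hobj θ').gradient, gradient, h, map_zero]
  rw [(hobj θ).gradient, ← sub_zero (_ • _), ← hzero, ← smul_sub, ← Finset.sum_sub_distrib]
  simp [subHessian, hhess]

/-- One step of NewSamp, in terms of the deviation of the sub-sampled Hessian. -/
theorem norm_iter_succ_sub_le (hf : ∀ i, IsQuadratic (f i)) {C : Set (Vec p)}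
    (hconv : Convex ℝ C) (hclosed : IsClosed C) {r : ℕ} (hr : r + 1 ≤ p) {θ' : Vec p} (hθ' : θ' ∈ C)
    (hmin : ∀ θ, objective f θ' ≤ objective f θ) (η : ℕ → ℝ) (S : ℕ → Finset (Fin n))
    (θ0 : Vec p) (t : ℕ) {A : Vec p →L[ℝ] Vec p}
    (hA : A = subHessian f (S t) (iter C r f η S θ0 t))
    (hpos : 0 < eig A (r + 1)) (hη : 0 < η t)
    (hη' : η t ≤ 2 / (1 + eig A p / eig A (r + 1))) {δ : ℝ}
    (hδ : ‖subHessian f Finset.univ (iter C r f η S θ0 t) - A‖ ≤ δ) :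
    ‖iter C r f η S θ0 (t + 1) - θ'‖ ≤
      (1 - η t * (eig A p / eig A (r + 1)) + η t * (δ / eig A (r + 1))) *
        ‖iter C r f η S θ0 t - θ'‖ := by
  have hsymm : (A : Vec p →ₗ[ℝ] Vec p).IsSymmetric := hA ▸ subHessian_isSymmetric hf _ _
  refine (norm_proj_sub_le hconv hclosed hθ' _).trans ?_
  rw [gradient_objective_eq hf hmin, ← hA]
  set θ := iter C r f η S θ0 t
  set B := subHessian f Finset.univ θ
  have hsplit : θ - η t • scaling r A (B (θ - θ')) - θ' =
      (ContinuousLinearMap.id ℝ (Vec p) - η t • (scaling r A).comp A) (θ - θ') -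
        η t • scaling r A ((B - A) (θ - θ')) := by
    simp only [FunLike.coe_sub, Pi.sub_apply, FunLike.coe_smul, Pi.smul_apply,
      ContinuousLinearMap.id_apply, ContinuousLinearMap.comp_apply, map_sub, smul_sub]
    abel
  have h1 := ContinuousLinearMap.le_of_opNorm_le _
    (norm_id_sub_scaling_comp_le hsymm hr hpos hη hη') (θ - θ')
  have h2 : ‖scaling r A ((B - A) (θ - θ'))‖ ≤ (eig A (r + 1))⁻¹ * (δ * ‖θ - θ'‖) :=
    (ContinuousLinearMap.le_of_opNorm_le _ (norm_scaling_le hsymm hr hpos) _).trans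
      (mul_le_mul_of_nonneg_left (ContinuousLinearMap.le_of_opNorm_le _ hδ _)
        (inv_nonneg.2 hpos.le))
  rw [hsplit]
  refine (norm_sub_le _ _).trans ?_
  rw [norm_smul, Real.norm_of_nonneg hη.le]
  calc _ ≤ (1 - η t * (eig A p / eig A (r + 1))) * ‖θ - θ'‖ +
        η t * ((eig A (r + 1))⁻¹ * (δ * ‖θ - θ'‖)) :=
      add_le_add h1 (mul_le_mul_of_nonneg_left h2 hη.le)
    _ = _ := by ring

end Quadratic

end NewSamp

namespace NewSamp

/-! ### Nets and operator norms. -/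

section Net

variable {E : Type*} [NormedAddCommGroup E] [NormedSpace ℝ E]

/-- A 1-separated subset of the ball of radius 2 with the most points is a net, since any uncovered
point could be added. Volume comparison gives the count `5^d`. -/
theorem exists_net_card_le [FiniteDimensional ℝ E] :
    ∃ N : Finset E, N.card ≤ 5 ^ Module.finrank ℝ E ∧ (∀ c ∈ N, ‖c‖ ≤ 2) ∧
      ∀ x : E, ‖x‖ ≤ 2 → ∃ c ∈ N, ‖x - c‖ ≤ 1 := by
  classical
  let good : Finset E → Prop := fun N =>
    (∀ c ∈ N, ‖c‖ ≤ 2) ∧ ∀ c ∈ N, ∀ d ∈ N, c ≠ d → 1 ≤ ‖c - d‖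
  let cards : Set ℕ := {k | ∃ N, good N ∧ N.card = k}
  have hbdd : BddAbove cards := ⟨5 ^ Module.finrank ℝ E, by
    rintro _ ⟨N, hN, rfl⟩
    exact Besicovitch.card_le_of_separated N hN.1 hN.2⟩
  have hne : cards.Nonempty := ⟨0, ∅, by simp [good], rfl⟩
  obtain ⟨N, hN, hcard⟩ := Nat.sSup_mem hne hbdd
  refine ⟨N, Besicovitch.card_le_of_separated N hN.1 hN.2, hN.1, fun x hx => ?_⟩
  by_contra! hfar
  have hxN : x ∉ N := fun h => by
    have := hfar x h
    simp only [sub_self, norm_zero] at this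
    linarith
  have hgood : good (insert x N) := by
    refine ⟨by simpa [hx] using hN.1, fun c hc d hd hcd => ?_⟩
    rcases Finset.mem_insert.1 hc with rfl | hcN <;>
      rcases Finset.mem_insert.1 hd with rfl | hdN
    · exact absurd rfl hcd
    · exact (hfar d hdN).le
    · rw [norm_sub_rev]
      exact (hfar c hcN).le
    · exact hN.2 c hcN d hdN hcd
  have := le_csSup hbdd (show (insert x N).card ∈ cards from ⟨_, hgood, rfl⟩)
  rw [Finset.card_insert_of_notMem hxN] at this
  omega

/-- With radius 2 and mesh 1, `2‖T‖ ≤ τ + ‖T‖`, so passing to the net loses no constant. -/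
theorem opNorm_le_of_net {F : Type*} [NormedAddCommGroup F] [NormedSpace ℝ F] {N : Finset E}
    (hN : ∀ x : E, ‖x‖ ≤ 2 → ∃ c ∈ N, ‖x - c‖ ≤ 1) (T : E →L[ℝ] F) {τ : ℝ} (hτ : 0 ≤ τ)
    (hT : ∀ c ∈ N, ‖T c‖ ≤ τ) : ‖T‖ ≤ τ := by
  have hball : ∀ x : E, ‖x‖ ≤ 2 → ‖T x‖ ≤ τ + ‖T‖ := by
    intro x hx
    obtain ⟨c, hc, hxc⟩ := hN x hx
    calc ‖T x‖ = ‖T c + T (x - c)‖ := by rw [← map_add, add_sub_cancel]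
      _ ≤ ‖T c‖ + ‖T (x - c)‖ := norm_add_le _ _
      _ ≤ τ + ‖T‖ * 1 := add_le_add (hT c hc) (T.le_opNorm_of_le hxc)
      _ = τ + ‖T‖ := by rw [mul_one]
  have hhalf : ‖T‖ ≤ (τ + ‖T‖) / 2 := by
    refine T.opNorm_le_of_unit_norm (by positivity) fun x hx => ?_
    have := hball ((2 : ℝ) • x) (by rw [norm_smul, hx]; norm_num)
    rw [map_smul, norm_smul, Real.norm_ofNat] at this
    linarith
  linarith

theorem opNorm_le_of_abs_inner_le {F : Type*} [NormedAddCommGroup F] [InnerProductSpace ℝ F]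
    {N : Finset F} (hN : ∀ x : F, ‖x‖ ≤ 2 → ∃ c ∈ N, ‖x - c‖ ≤ 1) (T : F →L[ℝ] F) {τ : ℝ}
    (hτ : 0 ≤ τ) (hT : ∀ x ∈ N, ∀ y ∈ N, |inner ℝ (T x) y| ≤ τ) : ‖T‖ ≤ τ :=
  opNorm_le_of_net hN T hτ fun x hx => by
    rw [← innerSL_apply_norm ℝ (T x)]
    exact opNorm_le_of_net hN _ hτ fun y hy => hT x hx y hy

end Net

/-! ### Concentration of sub-sampled Hessians. -/

section Concentration

variable {Ω Z : Type*} [MeasurableSpace Ω] [MeasurableSpace Z] {P : Measure Ω}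
  [IsProbabilityMeasure P]

/-- Two-sided Hoeffding inequality for variables with values in `[-b, b]` and common mean `m`. -/
theorem measureReal_le_abs_sum_sub_le {ι : Type*} {X : ι → Ω → ℝ} (hX : ∀ i, Measurable (X i))
    (hindep : iIndepFun X P) {b m : ℝ} (hb : ∀ i, ∀ᵐ ω ∂P, |X i ω| ≤ b)
    (hm : ∀ i, ∫ ω, X i ω ∂P = m) (T : Finset ι) {ε : ℝ} (hε : 0 ≤ ε) :
    P.real {ω | ε ≤ |∑ i ∈ T, (X i ω - m)|} ≤ 2 * Real.exp (-ε ^ 2 / (2 * (T.card * b ^ 2))) := by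
  have hsub : ∀ i, HasSubgaussianMGF (fun ω => X i ω - m) (‖b‖₊ ^ 2) P := by
    intro i
    have h := hasSubgaussianMGF_of_mem_Icc (hX i).aemeasurable
      ((hb i).mono fun ω hω => abs_le.1 hω)
    have h2 : ‖b - -b‖₊ / 2 = ‖b‖₊ := by
      rw [sub_neg_eq_add, ← two_mul, nnnorm_mul, Real.nnnorm_ofNat,
        mul_div_cancel_left₀ _ two_ne_zero]
    rwa [hm, h2] at h
  have hcoe : ((∑ _i ∈ T, ‖b‖₊ ^ 2 : NNReal) : ℝ) = T.card * b ^ 2 := by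
    simp
  have hpos := HasSubgaussianMGF.measure_sum_ge_le_of_iIndepFun
    (hindep.comp (fun _ x => x - m) fun _ => measurable_id.sub_const m) (s := T)
    (fun i _ => hsub i) hε
  have hneg := HasSubgaussianMGF.measure_sum_ge_le_of_iIndepFun
    (hindep.comp (fun _ x => -(x - m)) fun _ => (measurable_id.sub_const m).neg) (s := T)
    (fun i _ => (hsub i).neg) hε
  rw [hcoe] at hpos hneg
  rw [two_mul]
  refine le_trans ?_ (add_le_add hpos hneg)
  refine (measureReal_mono fun ω hω => ?_).trans (measureReal_union_le _ _)
  rcases le_abs.1 (Set.mem_ofPred_eq ▸ hω) with h | h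
  · exact Or.inl h
  · refine Or.inr ?_
    simpa only [Set.mem_ofPred_eq, Function.comp_apply, Finset.sum_neg_distrib] using h

/-- A tail bound uniform over fixed index sets also holds at a random index independent of the
data. -/
theorem measureReal_mem_random_index_le {ι : Type*} [Fintype ι] [MeasurableSpace ι]
    [MeasurableSingletonClass ι] {S : Ω → ι} {ζ : Ω → Z} (hS : Measurable S)
    (hindep : IndepFun S ζ P) {B : ι → Set Z} (hB : ∀ s, MeasurableSet (B s)) {q : ℝ}
    (hq : ∀ s, P.real (ζ ⁻¹' B s) ≤ q) : P.real {ω | ζ ω ∈ B (S ω)} ≤ q := by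
  -- Splitting by the value of `S` weights each fixed-index bound by `P(S = s)`; these weights sum
  -- to one, so the number of subsets does not enter.
  have hunion : {ω | ζ ω ∈ B (S ω)} = ⋃ s : ι, S ⁻¹' {s} ∩ ζ ⁻¹' B s := by
    ext ω
    simp
  calc P.real {ω | ζ ω ∈ B (S ω)} ≤ ∑ s, P.real (S ⁻¹' {s} ∩ ζ ⁻¹' B s) := by
        rw [hunion]
        exact measureReal_iUnion_fintype_le _
    _ = ∑ s, P.real (S ⁻¹' {s}) * P.real (ζ ⁻¹' B s) := by
        refine Finset.sum_congr rfl fun s _ => ?_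
        simp only [measureReal_def]
        rw [hindep.measure_inter_preimage_eq_mul _ _ (measurableSet_singleton s) (hB s),
          ENNReal.toReal_mul]
    _ ≤ ∑ s, P.real (S ⁻¹' {s}) * q := by
        gcongr with s
        exact hq s
    _ = q := by
        rw [← Finset.sum_mul, sum_measureReal_preimage_singleton _
          fun s _ => hS (measurableSet_singleton s)]
        simp

/-- The samples for which the sum over `T` of the second differences deviates from its mean by at
least `T.card * δ` for some pair of directions in `N`. -/
def deviationSet {n p : ℕ} (D : Measure Z) (φ : Z → Vec p → ℝ) (N : Finset (Vec p))
    (T : Finset (Fin n)) (δ : ℝ) : Set (Fin n → Z) :=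
  ⋃ xy ∈ N ×ˢ N, {ζ | T.card * δ ≤ |∑ i ∈ T, (secondDifference (φ (ζ i)) xy.1 xy.2 -
    ∫ ζ', secondDifference (φ ζ') xy.1 xy.2 ∂D)|}

variable {n p : ℕ} {D : Measure Z} {φ : Z → Vec p → ℝ} {z : Fin n → Ω → Z}

theorem measurable_secondDifference (hφ : ∀ θ, Measurable fun ζ => φ ζ θ) (x y : Vec p) :
    Measurable fun ζ => secondDifference (φ ζ) x y :=
  (((hφ _).sub (hφ _)).sub (hφ _)).add (hφ _)

theorem measurableSet_deviationSet (hφ : ∀ θ, Measurable fun ζ => φ ζ θ) (N : Finset (Vec p))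
    (T : Finset (Fin n)) (δ : ℝ) : MeasurableSet (deviationSet D φ N T δ) := by
  refine Finset.measurableSet_biUnion _ fun xy _ => measurableSet_le measurable_const ?_
  have h : Measurable fun ζ : Fin n → Z => ∑ i ∈ T, (secondDifference (φ (ζ i)) xy.1 xy.2 -
      ∫ ζ', secondDifference (φ ζ') xy.1 xy.2 ∂D) :=
    Finset.measurable_fun_sum _ fun i _ =>
      ((measurable_secondDifference hφ _ _).comp (measurable_pi_apply i)).sub_const _
  exact h.abs

/-- Net vectors have norm at most 2, so the variables are bounded by `4K` and the Hoeffding exponent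
is `|T|δ²/(32K²) ≥ 8p`. The at most `25^p ≤ e^{7p}` pairs leave `e^{-p}`. -/
theorem measureReal_deviationSet_le (hφ : ∀ θ, Measurable fun ζ => φ ζ θ)
    (hz : IIDObservations P D z) {K : ℝ} (hK : 0 < K)
    (hbdd : ∀ᵐ ω ∂P, ∀ i x y, |secondDifference (φ (z i ω)) x y| ≤ K * ‖x‖ * ‖y‖)
    {N : Finset (Vec p)} (hcard : N.card ≤ 5 ^ p) (hnorm : ∀ c ∈ N, ‖c‖ ≤ 2)
    {T : Finset (Fin n)} (hT : T.Nonempty) {δ : ℝ} (hδ : 0 ≤ δ)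
    (hδ' : 256 * K ^ 2 * p ≤ T.card * δ ^ 2) :
    P.real ((fun ω i => z i ω) ⁻¹' deviationSet D φ N T δ) ≤ 2 * Real.exp (-(p : ℝ)) := by
  obtain ⟨hzm, hlaw, hindep⟩ := hz
  have hT0 : (0 : ℝ) < T.card := by exact_mod_cast hT.card_pos
  have hpair : ∀ xy ∈ N ×ˢ N, P.real {ω | T.card * δ ≤
      |∑ i ∈ T, (secondDifference (φ (z i ω)) xy.1 xy.2 -
        ∫ ζ', secondDifference (φ ζ') xy.1 xy.2 ∂D)|} ≤ 2 * Real.exp (-(8 * p)) := by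
    rintro ⟨x, y⟩ hxy
    obtain ⟨hx, hy⟩ := Finset.mem_product.1 hxy
    have hmeas := measurable_secondDifference hφ x y
    refine (measureReal_le_abs_sum_sub_le (X := fun i ω => secondDifference (φ (z i ω)) x y)
      (b := 4 * K) (fun i => hmeas.comp (hzm i)) (hindep.comp _ fun _ => hmeas) (fun i => ?_)
      (fun i => ?_) T (by positivity)).trans ?_
    · filter_upwards [hbdd] with ω hω
      calc _ ≤ K * ‖x‖ * ‖y‖ := hω i x y
        _ ≤ K * 2 * 2 := by
          gcongr
          exacts [hnorm x hx, hnorm y hy]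
        _ = 4 * K := by ring
    · rw [← hlaw i, integral_map (hzm i).aemeasurable hmeas.aestronglyMeasurable]
    · gcongr
      rw [neg_div, neg_le_neg_iff, le_div_iff₀ (by positivity)]
      nlinarith [mul_le_mul_of_nonneg_left hδ' hT0.le]
  have hexp : (25 : ℝ) ≤ Real.exp 7 := by
    have h := Real.add_one_le_exp (1 : ℝ)
    calc (25 : ℝ) ≤ (1 + 1) ^ 7 := by norm_num
      _ ≤ Real.exp 1 ^ 7 := by gcongr
      _ = Real.exp 7 := by rw [← Real.exp_nat_mul]; norm_num
  have hcount : ((N ×ˢ N).card : ℝ) ≤ Real.exp (7 * p) := by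
    calc ((N ×ˢ N).card : ℝ) = (N.card : ℝ) * N.card := by
          rw [Finset.card_product, Nat.cast_mul]
      _ ≤ 5 ^ p * 5 ^ p := by
          have : (N.card : ℝ) ≤ 5 ^ p := by exact_mod_cast hcard
          gcongr
      _ = 25 ^ p := by rw [← mul_pow]; norm_num
      _ ≤ Real.exp 7 ^ p := by gcongr
      _ = Real.exp (7 * p) := by rw [← Real.exp_nat_mul, mul_comm]
  calc P.real ((fun ω i => z i ω) ⁻¹' deviationSet D φ N T δ)
      ≤ ∑ xy ∈ N ×ˢ N, P.real {ω | T.card * δ ≤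
          |∑ i ∈ T, (secondDifference (φ (z i ω)) xy.1 xy.2 -
            ∫ ζ', secondDifference (φ ζ') xy.1 xy.2 ∂D)|} := by
        simp only [deviationSet, Set.preimage_iUnion]
        exact measureReal_biUnion_finset_le _ _
    _ ≤ (N ×ˢ N).card • (2 * Real.exp (-(8 * p))) := Finset.sum_le_card_nsmul _ _ _ hpair
    _ ≤ Real.exp (7 * p) * (2 * Real.exp (-(8 * p))) := by
        rw [nsmul_eq_mul]
        gcongr
    _ = 2 * Real.exp (-(p : ℝ)) := by
        rw [mul_left_comm, ← Real.exp_add]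
        ring_nf

theorem abs_inner_subHessian_sub_le {f : Fin n → Vec p → ℝ} (hf : ∀ i, IsQuadratic (f i))
    {S : Finset (Fin n)} (hS : S.Nonempty) (θ x y : Vec p) {m δ : ℝ}
    (h : |∑ i ∈ S, (secondDifference (f i) x y - m)| ≤ S.card * δ) :
    |inner ℝ (subHessian f S θ x) y - m| ≤ δ := by
  have hS0 : (0 : ℝ) < S.card := by exact_mod_cast hS.card_pos
  have heq : inner ℝ (subHessian f S θ x) y - m =
      (S.card : ℝ)⁻¹ * ∑ i ∈ S, (secondDifference (f i) x y - m) := by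
    rw [inner_subHessian hf, Finset.sum_sub_distrib, Finset.sum_const, nsmul_eq_mul, mul_sub,
      inv_mul_cancel_left₀ hS0.ne']
  rw [heq, abs_mul, abs_of_pos (inv_pos.2 hS0), inv_mul_le_iff₀ hS0]
  exact h

/-- On the net both quadratic forms are within `δ` of the same mean, hence within `2δ` of each
other. -/
theorem norm_subHessian_univ_sub_le {ζ : Fin n → Z} (hf : ∀ i, IsQuadratic (φ (ζ i)))
    {N : Finset (Vec p)} (hN : ∀ x : Vec p, ‖x‖ ≤ 2 → ∃ c ∈ N, ‖x - c‖ ≤ 1)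
    {S : Finset (Fin n)} (hS : S.Nonempty) {δ : ℝ} (hδ : 0 ≤ δ)
    (hζS : ζ ∉ deviationSet D φ N S δ) (hζ : ζ ∉ deviationSet D φ N Finset.univ δ) (θ : Vec p) :
    ‖subHessian (fun i => φ (ζ i)) Finset.univ θ - subHessian (fun i => φ (ζ i)) S θ‖ ≤
      2 * δ := by
  refine opNorm_le_of_abs_inner_le hN _ (by positivity) fun x hx y hy => ?_
  have key : ∀ T : Finset (Fin n), T.Nonempty → ζ ∉ deviationSet D φ N T δ →
      |inner ℝ (subHessian (fun i => φ (ζ i)) T θ x) y -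
        ∫ ζ', secondDifference (φ ζ') x y ∂D| ≤ δ := by
    intro T hT hζT
    refine abs_inner_subHessian_sub_le hf hT θ x y (le_of_not_ge fun hge => hζT ?_)
    exact Set.mem_biUnion (x := (x, y)) (Finset.mem_coe.2 (Finset.mk_mem_product hx hy)) hge
  have h1 := abs_le.1 (key _ (hS.mono (Finset.subset_univ S)) hζ)
  have h2 := abs_le.1 (key S hS hζS)
  rw [FunLike.coe_sub, Pi.sub_apply, inner_sub_left, abs_le]
  constructor <;> linarith

/-- Uniform deviation of the Hessian sub-sampled at a random set independent of the data. -/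
theorem exists_measurableSet_norm_subHessian_sub_le (hφ : ∀ θ, Measurable fun ζ => φ ζ θ)
    (hz : IIDObservations P D z) {K : ℝ} (hK : 0 < K)
    (hbdd : ∀ᵐ ω ∂P, ∀ i x y, |secondDifference (φ (z i ω)) x y| ≤ K * ‖x‖ * ‖y‖)
    {S : Ω → Finset (Fin n)} (hS : Measurable S) (hindep : IndepFun S (fun ω i => z i ω) P) :
    ∃ B : Set Ω, MeasurableSet B ∧ P.real B ≤ 4 * Real.exp (-(p : ℝ)) ∧
      ∀ ω, ω ∉ B → (∀ i, IsQuadratic (φ (z i ω))) → (S ω).Nonempty → ∀ θ,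
        ‖subHessian (fun i => φ (z i ω)) Finset.univ θ -
          subHessian (fun i => φ (z i ω)) (S ω) θ‖ ≤ 32 * K * Real.sqrt (p / (S ω).card) := by
  classical
  obtain ⟨N, hcard, hnorm, hN⟩ := exists_net_card_le (E := Vec p)
  rw [finrank_euclideanSpace_fin] at hcard
  let δ : Finset (Fin n) → ℝ := fun s => 16 * K * Real.sqrt (p / s.card)
  let bad : Finset (Fin n) → Set (Fin n → Z) := fun s =>
    if s.Nonempty then deviationSet D φ N s (δ s) ∪ deviationSet D φ N Finset.univ (δ s) else ∅
  have hδ : ∀ s, 0 ≤ δ s := fun s => by positivity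
  have hbadm : ∀ s, MeasurableSet (bad s) := by
    intro s
    simp only [bad]
    split_ifs
    · exact (measurableSet_deviationSet hφ N _ _).union (measurableSet_deviationSet hφ N _ _)
    · exact MeasurableSet.empty
  -- The tolerance tuned to `s` also serves the full sample, which is at least as large.
  have hδsq : ∀ s T : Finset (Fin n), s.Nonempty → s ⊆ T →
      256 * K ^ 2 * p ≤ T.card * δ s ^ 2 := by
    intro s T hs hsT
    have hs0 : (0 : ℝ) < s.card := by exact_mod_cast hs.card_pos
    have hsT' : (s.card : ℝ) ≤ T.card := by exact_mod_cast Finset.card_le_card hsT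
    simp only [δ]
    rw [mul_pow, Real.sq_sqrt (by positivity)]
    calc 256 * K ^ 2 * p = s.card * ((16 * K) ^ 2 * (p / s.card)) := by
          field_simp
          ring
      _ ≤ T.card * ((16 * K) ^ 2 * (p / s.card)) := by gcongr
  have hbad : ∀ s, P.real ((fun ω i => z i ω) ⁻¹' bad s) ≤ 4 * Real.exp (-(p : ℝ)) := by
    intro s
    by_cases hs : s.Nonempty
    · simp only [bad, if_pos hs, Set.preimage_union]
      have h1 := measureReal_deviationSet_le hφ hz hK hbdd hcard hnorm hs (hδ s)
        (hδsq s s hs subset_rfl)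
      have h2 := measureReal_deviationSet_le hφ hz hK hbdd hcard hnorm
        (hs.mono (Finset.subset_univ s)) (hδ s) (hδsq s _ hs (Finset.subset_univ s))
      refine (measureReal_union_le _ _).trans ?_
      linarith
    · simp only [bad, if_neg hs, Set.preimage_empty, measureReal_empty]
      positivity
  refine ⟨{ω | (fun i => z i ω) ∈ bad (S ω)}, ?_,
    measureReal_mem_random_index_le hS hindep hbadm hbad, fun ω hω hquad hSω θ => ?_⟩
  · have : {ω | (fun i => z i ω) ∈ bad (S ω)} =
        ⋃ s, S ⁻¹' {s} ∩ (fun ω i => z i ω) ⁻¹' bad s := by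
      ext ω
      simp
    rw [this]
    exact MeasurableSet.iUnion fun s => (hS (measurableSet_singleton s)).inter
      (measurable_pi_lambda _ hz.1 (hbadm s))
  · simp only [bad, Set.mem_ofPred_eq, if_pos hSω, Set.mem_union, not_or] at hω
    refine (norm_subHessian_univ_sub_le (D := D) hquad hN hSω (hδ _) hω.1 hω.2 θ).trans_eq ?_
    simp only [δ]
    ring

end Concentration

/-- Since division by zero gives zero, `K = 0` or `s = 0` would make the argument vanish. -/
theorem pos_of_exp_lt_logArg {p : ℕ} {C : Set (Vec p)} {M : ℕ → ℝ} {K : ℝ} {n s : ℕ}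
    (h : Real.exp 1 < logArg C M K n s) : K ≠ 0 ∧ 0 < s := by
  have h0 : logArg C M K n s ≠ 0 := ((Real.exp_pos 1).trans h).ne'
  refine ⟨fun hK => h0 ?_, Nat.pos_of_ne_zero fun hs => h0 ?_⟩ <;> simp [logArg, *]

end NewSamp

/-! ### The one-step bound conditionally on `E`. -/

theorem corollary2 :
    ∃ c c' : ℝ, 0 < c ∧ 0 < c' ∧
      ∀ {Ω Z : Type*} [MeasurableSpace Ω] [MeasurableSpace Z]
        (P : Measure Ω) [IsProbabilityMeasure P] (D : Measure Z)
        (n p r : ℕ) (_hr : r + 1 ≤ p)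
        (C : Set (NewSamp.Vec p)) (_hCconv : Convex ℝ C) (_hCclosed : IsClosed C)
        (_hCbdd : Bornology.IsBounded C)
        (M : ℕ → ℝ) (K : ℝ)
        (φ : Z → NewSamp.Vec p → ℝ) (_hφ : ∀ θ, Measurable fun ζ => φ ζ θ)
        (z : Fin n → Ω → Z) (_hz : NewSamp.IIDObservations P D z)
        (_hLip : ∀ᵐ ω ∂P, NewSamp.LipschitzHessian C M fun i => φ (z i ω))
        (_hBdd : ∀ᵐ ω ∂P, NewSamp.BoundedHessian C K fun i => φ (z i ω))
        (_hQuad : ∀ᵐ ω ∂P, ∀ i, NewSamp.IsQuadratic (φ (z i ω)))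
        (S : ℕ → Ω → Finset (Fin n)) (_hS : NewSamp.SequentialSubsampling P z S)
        (θstar : Ω → NewSamp.Vec p) (_hθm : Measurable θstar)
        (_hθmin : ∀ᵐ ω ∂P, ∀ θ, NewSamp.objective (fun i => φ (z i ω)) (θstar ω) ≤
          NewSamp.objective (fun i => φ (z i ω)) θ)
        (E : Set Ω) (_hE : E = {ω | θstar ω ∈ C}) (_hEpos : P E ≠ 0)
        (η : ℕ → Ω → ℝ) (θ0 : Ω → NewSamp.Vec p)
        (θhat : ℕ → Ω → NewSamp.Vec p)
        (_hθhat : θhat = fun t ω => NewSamp.iter C r (fun i => φ (z i ω))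
          (fun τ => η τ ω) (fun τ => S τ ω) (θ0 ω) t)
        (H : ℕ → Ω → (NewSamp.Vec p →L[ℝ] NewSamp.Vec p))
        (_hH : H = fun t ω => NewSamp.subHessian (fun i => φ (z i ω)) (S t ω) (θhat t ω))
        (t : ℕ)
        (_hlog : ∀ᵐ ω ∂(cond P E), Real.exp 1 < NewSamp.logArg C M K n (S t ω).card)
        (_hpos : ∀ᵐ ω ∂(cond P E), 0 < NewSamp.eig (H t ω) (r + 1))
        (_hη : ∀ᵐ ω ∂(cond P E), 0 < η t ω ∧
          η t ω ≤ 2 / (1 + NewSamp.eig (H t ω) p / NewSamp.eig (H t ω) (r + 1))),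
        ∃ G : Set Ω, MeasurableSet G ∧
          1 - c / P.real E * Real.exp (-(p : ℝ)) ≤ (cond P E).real G ∧
          ∀ ω ∈ G, ‖θhat (t + 1) ω - θstar ω‖ ≤
            NewSamp.xi1 c' C M K n (S t ω).card r (η t ω) (H t ω) * ‖θhat t ω - θstar ω‖ := by
  -- `4` counts two deviation events of probability at most `2e^{-p}`; `32` is twice the `16` in the
  -- tolerance.
  refine ⟨4, 32, by norm_num, by norm_num, ?_⟩
  intro Ω Z _ _ P _ D n p r hr C hconv hclosed _ M K φ hφ z hz _ hBdd hQuad S hS θstar hθm hθmin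
    E hE hEpos η θ0 θhat hθhat H hH t hlog hpos hη
  have hEm : MeasurableSet E := hE ▸ hθm hclosed.measurableSet
  have : IsProbabilityMeasure (cond P E) := cond_isProbabilityMeasure hEpos
  have hae : ∀ {q : Ω → Prop}, (∀ᵐ ω ∂P, q ω) → ∀ᵐ ω ∂(cond P E), q ω := fun h =>
    cond_absolutelyContinuous.ae_le h
  have hmem : ∀ᵐ ω ∂(cond P E), θstar ω ∈ C := by
    filter_upwards [ae_cond_mem hEm] with ω hω
    rwa [hE] at hω
  obtain ⟨θ', hθ'⟩ : C.Nonempty := by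
    obtain ⟨ω, hω⟩ := hmem.exists
    exact ⟨_, hω⟩
  have hK : 0 < K := by
    obtain ⟨ω, hω, hωlog⟩ := ((hae hBdd).and hlog).exists
    obtain ⟨hK0, hcard⟩ := NewSamp.pos_of_exp_lt_logArg hωlog
    obtain ⟨i, -⟩ := Finset.card_pos.1 hcard
    exact lt_of_le_of_ne ((norm_nonneg _).trans (hω i θ' hθ')) hK0.symm
  have hdiff : ∀ᵐ ω ∂P, ∀ i x y,
      |NewSamp.secondDifference (φ (z i ω)) x y| ≤ K * ‖x‖ * ‖y‖ := by
    filter_upwards [hBdd, hQuad] with ω hω hq i x y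
    exact (hq i).abs_secondDifference_le (hω i θ' hθ') x y
  obtain ⟨B, hBm, hBP, hB⟩ := NewSamp.exists_measurableSet_norm_subHessian_sub_le hφ hz hK hdiff
    (hS.1 t) (hS.2.comp (measurable_pi_apply t) measurable_id)
  -- The almost sure conditions need not define a measurable set, so a measurable set of full
  -- conditional measure inside it is chosen.
  obtain ⟨T, hT, hTm, hTprop⟩ := (hmem.and ((hae hQuad).and ((hae hθmin).and
    (hlog.and (hpos.and hη))))).exists_measurable_mem
  refine ⟨T \ B, hTm.diff hBm, ?_, fun ω hω => ?_⟩
  · have hPE : 0 < P.real E := ENNReal.toReal_pos hEpos (measure_ne_top _ _)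
    have hTone : (cond P E).real T = 1 := by
      rw [measureReal_def, prob_compl_eq_zero_iff hTm |>.1 hT, ENNReal.toReal_one]
    have hBle : (cond P E).real B ≤ 4 / P.real E * Real.exp (-(p : ℝ)) := by
      rw [measureReal_def, cond_apply hEm, ENNReal.toReal_mul, ENNReal.toReal_inv,
        ← measureReal_def, ← measureReal_def]
      calc (P.real E)⁻¹ * P.real (E ∩ B) ≤ (P.real E)⁻¹ * (4 * Real.exp (-(p : ℝ))) := by
            gcongr
            exact (measureReal_mono Set.inter_subset_right).trans hBP
        _ = _ := by ring
    have hle := le_measureReal_sdiff (μ := cond P E) (s₁ := T) (s₂ := B)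
    linarith
  · obtain ⟨hmemω, hq, hmin, hlogω, hposω, hη0, hη1⟩ := hTprop ω hω.1
    obtain ⟨-, hcard⟩ := NewSamp.pos_of_exp_lt_logArg hlogω
    subst hθhat hH
    have hdev := hB ω hω.2 hq (Finset.card_pos.1 hcard) (NewSamp.iter C r (fun i => φ (z i ω))
      (fun τ => η τ ω) (fun τ => S τ ω) (θ0 ω) t)
    refine (NewSamp.norm_iter_succ_sub_le hq hconv hclosed hr hmemω hmin (fun τ => η τ ω)
      (fun τ => S τ ω) (θ0 ω) t rfl hposω hη0 hη1 hdev).trans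
      (mul_le_mul_of_nonneg_right ?_ (norm_nonneg _))
    -- The logarithm exceeds 1, so inserting it under the root only weakens the bound.
    have hlog1 : 1 ≤ Real.log (NewSamp.logArg C M K n (S t ω).card) :=
      ((Real.lt_log_iff_exp_lt ((Real.exp_pos 1).trans hlogω)).2 hlogω).le
    have hsqrt : Real.sqrt ((p : ℝ) / (S t ω).card) ≤ Real.sqrt ((p : ℝ) / (S t ω).card *
        Real.log (NewSamp.logArg C M K n (S t ω).card)) :=
      Real.sqrt_le_sqrt (le_mul_of_one_le_right (by positivity) hlog1)
    rw [NewSamp.xi1, mul_assoc (η t ω), div_mul_eq_mul_div]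
    gcongr
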